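/- Let $a\ge -1$ be an integer, and write $a=3A+a_0$ with $A\in\mathbb Z$ and $a_0\in\{0,1,2\}$ (so $A\ge 0$, unless $a=-1$, when $A=-1$ and $a_0=2$). Let $K=\mathbb Q(\rho)$ be the field generated by a root $\rho$ of the polynomial $x^3-ax^2-(a+3)x-1$, and assume that its ring of algebraic integers is $\mathcal O_K=\mathbb Z[\rho]$. An element of $K$ is called totally positive if its image under every embedding $K\to\mathbb R$ is positive, and an element $\alpha\in\mathcal O_K$ is called indecomposable in $\mathcal O_K$ if it is totally positive and cannot be written as $\alpha=\beta+\gamma$ with totally positive $\beta,\gamma\in\mathcal O_K$. Let $N$ denote the norm from $K$ to $\mathbb Q$, and put \[ B=\begin{cases} a^2+3a+9 & \text{if } a\le 3,\\ 3A^4+14A^3+28A^2+27A+11 & \text{if } a\ge 4 \text{ and } a_0=2,\\ 3A^4+10A^3+16A^2+13A+5 & \text{if } a\ge 4 \text{ and } a_0=1,\\ 3A^4+6A^3+9A^2+6A+3 & \text{if } a\ge 4 \text{ and } a_0=0. \end{cases} \] Then every indecomposable $\alpha$ in $\mathcal O_K$ satisfies $N(\alpha)\le B$. Moreover, this bound is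 sharp: there is an indecomposable $\alpha$ in $\mathcal O_K$ with $N(\alpha)=B$. -/

import Mathlib

open scoped NumberField

/-- An element of a field `K` is totally positive if its image under every embedding of `K`
into `ℝ` is positive. -/
def IsTotallyPositive {K : Type*} [Field K] (x : K) : Prop :=
  ∀ σ : K →+* ℝ, 0 < σ x

/-- An algebraic integer `α` of `K` is indecomposable in `𝓞 K` if it is totally positive and is
not the sum of two totally positive elements of `𝓞 K`. -/
def IsIndecomposable {K : Type*} [Field K] (α : 𝓞 K) : Prop :=
  IsTotallyPositive (α : K) ∧
    ¬ ∃ β γ : 𝓞 K, IsTotallyPositive (β : K) ∧ IsTotallyPositive (γ : K) ∧ α = β + γ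

/-- The bound for the parameter `a = 3 * A + a₀`, where `a₀ ∈ {0, 1, 2}`. -/
def simplestCubicBound (A a₀ : ℤ) : ℤ :=
  if 3 * A + a₀ ≤ 3 then (3 * A + a₀) ^ 2 + 3 * (3 * A + a₀) + 9
  else if a₀ = 2 then 3 * A ^ 4 + 14 * A ^ 3 + 28 * A ^ 2 + 27 * A + 11
  else if a₀ = 1 then 3 * A ^ 4 + 10 * A ^ 3 + 16 * A ^ 2 + 13 * A + 5
  else 3 * A ^ 4 + 6 * A ^ 3 + 9 * A ^ 2 + 6 * A + 3

/-! Multiplication by the square of a unit preserves norm, total positivity and indecomposability,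
so it is enough to study two simplicial cones, spanned by `1, θ², (1 + θ)²` and by `1, θ², (θ / (1 +
θ))²`, whose translates cover all totally positive elements (`exists_mul_sq_mem_cone`). An
indecomposable element of a cone, other than a generator, has all cone coordinates below one, since
otherwise a generator could be subtracted. Only finitely many lattice points remain.

The first cone has index 2 and leaves only `1 + θ + θ²`, of norm `a² + 3a + 9`. The second has index
`D = a² + 3a + 3`, and its generators have height `x + z = 1`, so the points left have height 1 or
2. Those of height 1 form a triangle `p, q, r ≥ 0`, `p + q + r = a`; each of height 2 is a sum of
two of them. On the triangle the norm is largest at the lattice points nearest the centroid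
(`triangleNorm_le`). The split at `a = 3` records which of the two norms is larger.

For sharpness, `x + z` is positive on totally positive elements (`exists_positive_functional`) and
integral, so height 1 forces indecomposability. Its pullbacks by squares of units settle `1 + θ +
θ²`. -/

namespace SimplestCubic

/-! ### The norm form on the triangle -/

/-- The product is positive only if two factors are negative, say `x, y`. Then `3xy ≤ x² + xy + y²`,
and the third factor is at most `2a`. -/
theorem three_mul_mul_mul_le {a U V W : ℤ} (hs : U + V + W = 0) (hU : -a ≤ U) (hV : -a ≤ V)
    (hW : -a ≤ W) : 3 * (U * V * W) ≤ 2 * a * (U ^ 2 + U * V + V ^ 2) := by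
  have key : ∀ x y : ℤ, -a ≤ x → -a ≤ y → x ≤ 0 → y ≤ 0 →
      3 * (x * y * (-x - y)) ≤ 2 * a * (x ^ 2 + x * y + y ^ 2) := by
    intro x y hx hy hx0 hy0
    have h1 : (-x - y) * (x ^ 2 + x * y + y ^ 2) ≤ 2 * a * (x ^ 2 + x * y + y ^ 2) :=
      mul_le_mul_of_nonneg_right (by linarith) (by nlinarith [sq_nonneg (x + y), sq_nonneg x])
    have h2 : 0 ≤ (-x - y) * (x - y) ^ 2 := mul_nonneg (by linarith) (sq_nonneg _)
    nlinarith
  have hQ : 0 ≤ U ^ 2 + U * V + V ^ 2 := by nlinarith [sq_nonneg (U + V), sq_nonneg U, sq_nonneg V]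
  have ha : 0 ≤ a := by linarith
  obtain rfl : W = -U - V := by linarith
  rcases le_total 0 U with h1 | h1 <;> rcases le_total 0 V with h2 | h2
  · have : 0 ≤ U * V * (U + V) := by positivity
    have := mul_nonneg ha hQ
    nlinarith
  · rcases le_total 0 (-U - V) with h3 | h3
    · have : 0 ≤ U * (-V) * (-U - V) := mul_nonneg (mul_nonneg h1 (by linarith)) h3
      have := mul_nonneg ha hQ
      nlinarith
    · have := key V (-U - V) hV hW h2 h3
      ring_nf at this ⊢
      linarith
  · rcases le_total 0 (-U - V) with h3 | h3
    · have : 0 ≤ (-U) * V * (-U - V) := mul_nonneg (mul_nonneg (by linarith) h2) h3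
      have := mul_nonneg ha hQ
      nlinarith
    · have := key U (-U - V) hU hW h1 h3
      ring_nf at this ⊢
      linarith
  · exact key U V hU hV h1 h2

/-- The difference of the two sides is the cyclic sum of `(a + U) V²`. -/
theorem cubic_le {a U V W : ℤ} (hs : U + V + W = 0) (hU : -a ≤ U) (hV : -a ≤ V)
    (hW : -a ≤ W) : U ^ 3 - 3 * U * V ^ 2 - V ^ 3 ≤ 2 * a * (U ^ 2 + U * V + V ^ 2) := by
  have h1 : 0 ≤ (a + U) * V ^ 2 := mul_nonneg (by linarith) (sq_nonneg _)
  have h2 : 0 ≤ (a + V) * W ^ 2 := mul_nonneg (by linarith) (sq_nonneg _)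
  have h3 : 0 ≤ (a + W) * U ^ 2 := mul_nonneg (by linarith) (sq_nonneg _)
  obtain rfl : W = -U - V := by linarith
  linarith

/-- The norm of `triangleElt θ a p q`, as a polynomial. -/
def triangleNorm (a p q : ℤ) : ℤ :=
  a ^ 2 * p * q - a * p ^ 2 * q - a * p * q ^ 2 + a ^ 2 * p - 2 * a * p ^ 2 + a * p * q + a * q ^ 2
    + p ^ 3 - 3 * p * q ^ 2 - q ^ 3 + 3 * a * p + 3 * a * q - 3 * p ^ 2 - 3 * p * q - 3 * q ^ 2
    + 2 * a + 3

/-- Expansion around the centroid `U = V = W = 0`, where the linear term vanishes. -/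
theorem triangleNorm_identity (a p q : ℤ) {U V W : ℤ} (hU : U = 3 * p - a) (hV : V = 3 * q - a)
    (hW : W = -U - V) :
    27 * triangleNorm a p q = (a ^ 2 + 3 * a + 9) ^ 2 -
      ((a ^ 2 + 3 * a + 9) * (U ^ 2 + U * V + V ^ 2) - a * (U * V * W)
        - (U ^ 3 - 3 * U * V ^ 2 - V ^ 3)) := by
  subst hU hV hW
  unfold triangleNorm
  ring

/-- The cubic terms cost at most `(2a² + 6a)` times the quadratic form, out of `3(a² + 3a + 9)`; the
factor `a² + 3a + 27` is what is left. -/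
theorem triangleNorm_le_sub {a p q r : ℤ} (hp : 0 ≤ p) (hq : 0 ≤ q) (hr : 0 ≤ r)
    (hs : p + q + r = a) :
    81 * triangleNorm a p q ≤ 3 * (a ^ 2 + 3 * a + 9) ^ 2 -
      (a ^ 2 + 3 * a + 27) * ((3 * p - a) ^ 2 + (3 * p - a) * (3 * q - a) + (3 * q - a) ^ 2) := by
  have h1 := triangleNorm_identity a p q rfl rfl rfl
  have hs' : (3 * p - a) + (3 * q - a) + (-(3 * p - a) - (3 * q - a)) = 0 := by ring
  have h2 := three_mul_mul_mul_le (a := a) hs' (by linarith) (by linarith) (by linarith)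
  have h3 := cubic_le (a := a) hs' (by linarith) (by linarith) (by linarith)
  have h4 := mul_le_mul_of_nonneg_left h2 (show 0 ≤ a by linarith)
  generalize 3 * p - a = U at *
  generalize 3 * q - a = V at *
  linarith

/-- For `a₀ = 0` the centroid is a lattice point. Otherwise the three lattice points nearest to it
share the same norm, found by evaluation, and farther points lose enough through the quadratic term.
-/
theorem triangleNorm_le {A a₀ p q r : ℤ} (ha₀ : a₀ = 0 ∨ a₀ = 1 ∨ a₀ = 2) (hp : 0 ≤ p) (hq : 0 ≤ q)
    (hr : 0 ≤ r) (hs : p + q + r = 3 * A + a₀) :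
    triangleNorm (3 * A + a₀) p q ≤ if a₀ = 2 then 3 * A ^ 4 + 14 * A ^ 3 + 28 * A ^ 2 + 27 * A + 11
      else if a₀ = 1 then 3 * A ^ 4 + 10 * A ^ 3 + 16 * A ^ 2 + 13 * A + 5
      else 3 * A ^ 4 + 6 * A ^ 3 + 9 * A ^ 2 + 6 * A + 3 := by
  have hA : 0 ≤ A := by omega
  have h := triangleNorm_le_sub hp hq hr hs
  obtain ⟨i, rfl⟩ : ∃ i, p = A + i := ⟨p - A, by ring⟩
  obtain ⟨j, rfl⟩ : ∃ j, q = A + j := ⟨q - A, by ring⟩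
  rcases ha₀ with rfl | rfl | rfl
  · norm_num
    have h5 : 0 ≤ ((3 * A) ^ 2 + 3 * (3 * A) + 27) * (i ^ 2 + i * j + j ^ 2) :=
      mul_nonneg (by positivity) (by nlinarith [sq_nonneg (i + j), sq_nonneg i, sq_nonneg j])
    norm_num at h
    nlinarith
  · norm_num at h ⊢
    -- With `U = 3i - 1`, `V = 3j - 1` the quadratic form is `9k + 3`, where `k` is the expression
    -- compared with 1.
    rcases le_or_gt 1 (i ^ 2 + i * j + j ^ 2 - i - j) with hk | hk
    · have h5 := mul_le_mul_of_nonneg_left hk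
        (show 0 ≤ (3 * A + 1) ^ 2 + 3 * (3 * A + 1) + 27 by positivity)
      nlinarith
    · have hi0 : 0 ≤ i := by nlinarith [sq_nonneg (i + j), sq_nonneg (j - 1)]
      have hj0 : 0 ≤ j := by nlinarith [sq_nonneg (i + j), sq_nonneg (i - 1)]
      have hij : i + j ≤ 1 := by nlinarith [sq_nonneg (i - 1), sq_nonneg (j - 1)]
      obtain ⟨rfl, rfl⟩ | ⟨rfl, rfl⟩ | ⟨rfl, rfl⟩ : i = 0 ∧ j = 0 ∨ i = 0 ∧ j = 1 ∨ i = 1 ∧ j = 0 := by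
        omega
      all_goals unfold triangleNorm; apply le_of_eq; ring
  · norm_num at h ⊢
    -- Here `U = 3i - 2`, `V = 3j - 2`, and the quadratic form is `9k + 12`.
    rcases le_or_gt 0 (i ^ 2 + i * j + j ^ 2 - 2 * i - 2 * j) with hk | hk
    · have h5 := mul_nonneg
        (show 0 ≤ (3 * A + 2) ^ 2 + 3 * (3 * A + 2) + 27 by positivity) hk
      nlinarith
    · have hi0 : 0 ≤ i := by nlinarith [sq_nonneg (i + j), sq_nonneg (i + 2 * j - 2)]
      have hj0 : 0 ≤ j := by nlinarith [sq_nonneg (i + j), sq_nonneg (2 * i + j - 2)]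
      have hij : i + j ≤ 2 := by nlinarith [sq_nonneg (i - j)]
      have hij' : 0 < i + j := by nlinarith [sq_nonneg (i - j), mul_nonneg hi0 hj0]
      have hi2 : i ≤ 1 := by nlinarith
      have hj2 : j ≤ 1 := by nlinarith
      obtain ⟨rfl, rfl⟩ | ⟨rfl, rfl⟩ | ⟨rfl, rfl⟩ : i = 1 ∧ j = 1 ∨ i = 0 ∧ j = 1 ∨ i = 1 ∧ j = 0 := by
        omega
      all_goals unfold triangleNorm; apply le_of_eq; ring

theorem simplestCubicBound_of_nonneg {A a₀ : ℤ} (ha₀ : a₀ = 0 ∨ a₀ = 1 ∨ a₀ = 2)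
    (h : 0 ≤ 3 * A + a₀) :
    (if a₀ = 2 then 3 * A ^ 4 + 14 * A ^ 3 + 28 * A ^ 2 + 27 * A + 11
      else if a₀ = 1 then 3 * A ^ 4 + 10 * A ^ 3 + 16 * A ^ 2 + 13 * A + 5
      else 3 * A ^ 4 + 6 * A ^ 3 + 9 * A ^ 2 + 6 * A + 3) ≤ simplestCubicBound A a₀ := by
  unfold simplestCubicBound
  split_ifs with h1 h2 h3 <;> try exact le_rfl
  · obtain rfl : A = 0 := by omega
    subst h1
    norm_num
  · obtain rfl : A = 0 := by omega
    subst h3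
    norm_num
  · obtain rfl : a₀ = 0 := by omega
    obtain rfl | rfl : A = 0 ∨ A = 1 := by omega
    all_goals norm_num

theorem le_simplestCubicBound {A a₀ : ℤ} (ha₀ : a₀ = 0 ∨ a₀ = 1 ∨ a₀ = 2) :
    (3 * A + a₀) ^ 2 + 3 * (3 * A + a₀) + 9 ≤ simplestCubicBound A a₀ := by
  unfold simplestCubicBound
  split_ifs with h1 h2 h3
  · exact le_rfl
  · have : 1 ≤ A := by omega
    obtain ⟨b, rfl⟩ : ∃ b, A = b + 1 := ⟨A - 1, by ring⟩
    have hb : 0 ≤ b := by omega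
    subst h2
    have h2 : 0 ≤ 3 * b ^ 4 + 26 * b ^ 3 + 79 * b ^ 2 := by positivity
    nlinarith
  · have : 1 ≤ A := by omega
    obtain ⟨b, rfl⟩ : ∃ b, A = b + 1 := ⟨A - 1, by ring⟩
    have hb : 0 ≤ b := by omega
    subst h3
    have h2 : 0 ≤ 3 * b ^ 4 + 22 * b ^ 3 + 55 * b ^ 2 := by positivity
    nlinarith
  · obtain rfl : a₀ = 0 := by omega
    have : 2 ≤ A := by omega
    obtain ⟨b, rfl⟩ : ∃ b, A = b + 2 := ⟨A - 2, by ring⟩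
    have hb : 0 ≤ b := by omega
    have h2 : 0 ≤ 3 * b ^ 4 + 30 * b ^ 3 := by positivity
    nlinarith

/-! ### The simplest cubic polynomial and its real embeddings -/

open Polynomial in
/-- The simplest cubic polynomial `X ^ 3 - a X ^ 2 - (a + 3) X - 1`. -/
noncomputable def poly (a : ℤ) : ℤ[X] := X ^ 3 - C a * X ^ 2 - C (a + 3) * X - 1

open Polynomial in
theorem poly_natDegree (a : ℤ) : (poly a).natDegree = 3 := by
  unfold poly
  compute_degree!

open Polynomial in
theorem poly_monic (a : ℤ) : (poly a).Monic := by
  unfold poly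
  monicity!

open Polynomial in
theorem poly_irreducible (a : ℤ) : Irreducible (poly a) := by
  have h3 := poly_natDegree a
  rw [(poly_monic a).irreducible_iff_roots_eq_zero_of_degree_le_three (by omega) (by omega)]
  refine Multiset.eq_zero_of_forall_notMem fun x hx => ?_
  have hx' : x ^ 3 - a * x ^ 2 - (a + 3) * x - 1 = 0 := by
    have := (mem_roots'.1 hx).2
    simpa [IsRoot.def, poly] using this
  have hu : IsUnit x :=
    IsUnit.of_mul_eq_one (x ^ 2 - a * x - (a + 3)) (by linear_combination hx')
  -- The value at `1` is `-2a - 3`, which is odd; the value at `-1` is `1`.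
  rcases Int.isUnit_iff.1 hu with rfl | rfl
  · omega
  · omega

section Embeddings

variable {K : Type*} [Field K] [NumberField K] {ρ : K} {a : ℤ}

open Polynomial in
theorem minpoly_eq (hρ : ρ ^ 3 - (a : K) * ρ ^ 2 - ((a : K) + 3) * ρ - 1 = 0) :
    minpoly ℚ ρ = (poly a).map (Int.castRingHom ℚ) := by
  refine (minpoly.eq_of_irreducible_of_monic ?_ ?_ ((poly_monic a).map _)).symm
  · exact ((poly_monic a).irreducible_iff_irreducible_map_fraction_map (K := ℚ)).1
      (poly_irreducible a)
  · have h3 : aeval ρ (3 : ℚ[X]) = 3 := map_ofNat _ 3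
    simpa [poly, h3] using hρ

theorem exists_ringHom_apply_eq (hρ : ρ ^ 3 - (a : K) * ρ ^ 2 - ((a : K) + 3) * ρ - 1 = 0)
    (hK : IntermediateField.adjoin ℚ {ρ} = ⊤) {t : ℝ}
    (ht : t ^ 3 - a * t ^ 2 - (a + 3) * t - 1 = 0) : ∃ σ : K →+* ℝ, σ ρ = t := by
  have hi : IsIntegral ℚ ρ := Algebra.IsIntegral.isIntegral ρ
  let pb := IntermediateField.adjoin.powerBasis hi
  have hz : Polynomial.aeval t ((poly a).map (Int.castRingHom ℚ)) = 0 := by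
    have h3 : Polynomial.aeval t (3 : Polynomial ℚ) = 3 := map_ofNat _ 3
    simpa [poly, h3] using ht
  rw [← minpoly_eq hρ, ← IntermediateField.minpoly_gen, ← IntermediateField.adjoin.powerBasis_gen hi]
    at hz
  have hm : ∀ x : K, x ∈ IntermediateField.adjoin ℚ {ρ} := fun x => hK ▸ IntermediateField.mem_top
  let e : K →+* IntermediateField.adjoin ℚ {ρ} :=
    (RingHom.id K).codRestrict (IntermediateField.adjoin ℚ {ρ}) hm
  refine ⟨(pb.lift t hz).toRingHom.comp e, ?_⟩
  have : e ρ = pb.gen := by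
    rw [IntermediateField.adjoin.powerBasis_gen]
    rfl
  simp [this]

theorem exists_real_root (a : ℤ) :
    ∃ t : ℝ, -1 < t ∧ t < 0 ∧ t ^ 3 - a * t ^ 2 - (a + 3) * t - 1 = 0 := by
  have hc : ContinuousOn (fun t : ℝ => t ^ 3 - a * t ^ 2 - (a + 3) * t - 1) (Set.Icc (-1) 0) := by
    fun_prop
  obtain ⟨t, ht, h⟩ := intermediate_value_Ioo' (by norm_num) hc
    (show (0 : ℝ) ∈ Set.Ioo _ _ by constructor <;> ring_nf <;> norm_num)
  exact ⟨t, ht.1, ht.2, h⟩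

end Embeddings

/-! ### Integral coordinates and the positive functional -/

section Elements

variable {K : Type*} [Field K]

/-- The element `x + y θ + z θ ^ 2`. -/
def elt (θ : 𝓞 K) (x y z : ℤ) : 𝓞 K := x + y * θ + z * θ ^ 2

theorem exists_eq_elt {θ : 𝓞 K} {a : ℤ} (hθ : θ ^ 3 = a * θ ^ 2 + (a + 3) * θ + 1)
    (hO : integralClosure ℤ K = Algebra.adjoin ℤ {(θ : K)}) (α : 𝓞 K) :
    ∃ x y z : ℤ, α = elt θ x y z := by
  suffices h : ∀ β ∈ Algebra.adjoin ℤ {(θ : K)}, ∃ x y z : ℤ, β = (elt θ x y z : 𝓞 K) by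
    obtain ⟨x, y, z, h⟩ := h α (hO ▸ α.isIntegral_coe)
    exact ⟨x, y, z, NumberField.RingOfIntegers.ext h⟩
  intro β hβ
  induction hβ using Algebra.adjoin_induction with
  | mem x hx =>
    refine ⟨0, 1, 0, ?_⟩
    simpa [elt] using hx
  | algebraMap n => exact ⟨n, 0, 0, by simp [elt]⟩
  | add β γ _ _ h1 h2 =>
    obtain ⟨x, y, z, rfl⟩ := h1
    obtain ⟨x', y', z', rfl⟩ := h2
    refine ⟨x + x', y + y', z + z', ?_⟩
    rw [← map_add]
    congr 1
    simp only [elt]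
    push_cast
    ring
  | mul β γ _ _ h1 h2 =>
    obtain ⟨x, y, z, rfl⟩ := h1
    obtain ⟨x', y', z', rfl⟩ := h2
    refine ⟨x * x' + (y * z' + z * y') + a * (z * z'),
      x * y' + y * x' + (a + 3) * (y * z' + z * y') + (a * (a + 3) + 1) * (z * z'),
      x * z' + y * y' + z * x' + a * (y * z' + z * y') + (a * a + a + 3) * (z * z'), ?_⟩
    rw [← map_mul]
    congr 1
    simp only [elt]
    push_cast
    linear_combination (y * z' + z * y' + a * (z * z') + z * z' * θ) * hθ

variable [NumberField K]

/-- The functional `x + y θ + z θ ^ 2 ↦ x + z` is a positive combination of the real embeddings. -/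
theorem exists_positive_functional {θ : 𝓞 K} {a : ℤ}
    (hθ : θ ^ 3 = a * θ ^ 2 + (a + 3) * θ + 1) (hK : IntermediateField.adjoin ℚ {(θ : K)} = ⊤) :
    ∃ Φ : 𝓞 K →+ ℝ, (∀ x y z, Φ (elt θ x y z) = x + z) ∧
      ∀ α : 𝓞 K, IsTotallyPositive (α : K) → 0 < Φ α := by
  have hρ : (θ : K) ^ 3 - (a : K) * (θ : K) ^ 2 - ((a : K) + 3) * (θ : K) - 1 = 0 := by
    have := congrArg (algebraMap (𝓞 K) K) hθ
    simp only [map_add, map_mul, map_pow, map_intCast, map_one, map_ofNat] at this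
    linear_combination this
  obtain ⟨t, h1, h0, ht⟩ := exists_real_root a
  have ht0 : t ≠ 0 := h0.ne
  have ht1 : 1 + t ≠ 0 := by linarith
  -- The other roots are the images of `t` under the order-three map `t ↦ -1 - 1/t` and its inverse;
  -- they are ordered `v < -1 < t < 0 < u`.
  set u : ℝ := -1 - 1 / t with hu
  set v : ℝ := -1 / (1 + t) with hv
  have hut : u * t = -t - 1 := by rw [hu]; field_simp
  have hvt : v * (1 + t) = -1 := by rw [hv]; field_simp
  have hu0 : 0 < u := by
    have : 1 / t < -1 := by rw [div_lt_iff_of_neg h0]; linarith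
    linarith
  have hv1 : v < -1 := by rw [hv, div_lt_iff₀ (by linarith)]; linarith
  have hur : u ^ 3 - a * u ^ 2 - (a + 3) * u - 1 = 0 := by
    have : t ^ 3 * (u ^ 3 - a * u ^ 2 - (a + 3) * u - 1) = 0 := by
      have e : t ^ 3 * (u ^ 3 - a * u ^ 2 - (a + 3) * u - 1) =
        (u * t) ^ 3 - a * (u * t) ^ 2 * t - (a + 3) * (u * t) * t ^ 2 - t ^ 3 := by ring
      rw [e, hut]
      linear_combination ht
    exact (mul_eq_zero.1 this).resolve_left (pow_ne_zero _ ht0)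
  have hvr : v ^ 3 - a * v ^ 2 - (a + 3) * v - 1 = 0 := by
    have : (1 + t) ^ 3 * (v ^ 3 - a * v ^ 2 - (a + 3) * v - 1) = 0 := by
      have e : (1 + t) ^ 3 * (v ^ 3 - a * v ^ 2 - (a + 3) * v - 1) =
        (v * (1 + t)) ^ 3 - a * (v * (1 + t)) ^ 2 * (1 + t) - (a + 3) * (v * (1 + t)) * (1 + t) ^ 2
          - (1 + t) ^ 3 := by ring
      rw [e, hvt]
      linear_combination -ht
    exact (mul_eq_zero.1 this).resolve_left (pow_ne_zero _ ht1)
  obtain ⟨σ₁, hσ₁⟩ := exists_ringHom_apply_eq hρ hK hur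
  obtain ⟨σ₂, hσ₂⟩ := exists_ringHom_apply_eq hρ hK hvr
  obtain ⟨σ₃, hσ₃⟩ := exists_ringHom_apply_eq hρ hK ht
  have huv : 0 < u - v := by linarith
  have hut' : 0 < u - t := by linarith
  have hvt' : 0 < t - v := by linarith
  -- Lagrange interpolation: these weights give `1, 0, 1` on `1, θ, θ²`.
  let c₁ : ℝ := (1 + v * t) / ((u - v) * (u - t))
  let c₂ : ℝ := (1 + u * t) / ((u - v) * (t - v))
  let c₃ : ℝ := -(1 + u * v) / ((u - t) * (t - v))
  have hc₁ : 0 < c₁ := div_pos (by nlinarith) (mul_pos huv hut')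
  have hc₂ : 0 < c₂ := div_pos (by linarith) (mul_pos huv hvt')
  have hc₃ : 0 < c₃ := by
    refine div_pos ?_ (mul_pos hut' hvt')
    have : (1 + u * v) * t = 1 + t := by linear_combination v * hut - hvt
    nlinarith
  let F : (K →+* ℝ) → ℝ → 𝓞 K →+ ℝ := fun σ c =>
    (AddMonoidHom.mulLeft c).comp ((σ.comp (algebraMap (𝓞 K) K)) : 𝓞 K →+ ℝ)
  have hF : ∀ σ c α, F σ c α = c * σ (α : K) := fun _ _ _ => rfl
  refine ⟨F σ₁ c₁ + F σ₂ c₂ + F σ₃ c₃, fun x y z => ?_, fun α hα => ?_⟩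
  · simp only [AddMonoidHom.add_apply, hF, elt, map_add, map_mul, map_pow, map_intCast, hσ₁, hσ₂,
      hσ₃, c₁, c₂, c₃]
    have := huv.ne'
    have := hut'.ne'
    have := hvt'.ne'
    field_simp
    ring
  · simp only [AddMonoidHom.add_apply, hF]
    have := mul_pos hc₁ (hα σ₁)
    have := mul_pos hc₂ (hα σ₂)
    have := mul_pos hc₃ (hα σ₃)
    linarith

end Elements

/-! ### Total positivity and cones of squares of units -/

section Positive

variable {K : Type*} [Field K]

theorem map_unit_sq_pos (σ : K →+* ℝ) (u : (𝓞 K)ˣ) :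
    0 < σ (algebraMap (𝓞 K) K ((u : 𝓞 K) ^ 2)) := by
  have h := (u.isUnit.map (σ.comp (algebraMap (𝓞 K) K))).ne_zero
  rw [map_pow, map_pow]
  exact sq_pos_of_ne_zero h

theorem isTotallyPositive_mul_sq {α : 𝓞 K} (hα : IsTotallyPositive (α : K)) (u : (𝓞 K)ˣ) :
    IsTotallyPositive ((α * (u : 𝓞 K) ^ 2 : 𝓞 K) : K) := fun σ => by
  simp only [map_mul]
  exact mul_pos (hα σ) (map_unit_sq_pos σ u)

/-- An element with a positive multiple in the cone of three squares of units is totally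
positive. -/
theorem isTotallyPositive_of_mul_eq {γ : 𝓞 K} {m t₁ t₂ t₃ : ℤ} (u₁ u₂ u₃ : (𝓞 K)ˣ) (hm : 0 < m)
    (h₁ : 0 ≤ t₁) (h₂ : 0 ≤ t₂) (h₃ : 0 ≤ t₃) (hs : 0 < t₁ + t₂ + t₃)
    (h : m * γ = t₁ * (u₁ : 𝓞 K) ^ 2 + t₂ * (u₂ : 𝓞 K) ^ 2 + t₃ * (u₃ : 𝓞 K) ^ 2) :
    IsTotallyPositive (γ : K) := by
  intro σ
  have h' := congrArg (fun β : 𝓞 K => σ (β : K)) h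
  simp only [map_add, map_mul, map_intCast] at h'
  have p₁ := map_unit_sq_pos σ u₁
  have p₂ := map_unit_sq_pos σ u₂
  have p₃ := map_unit_sq_pos σ u₃
  have hm' : (0 : ℝ) < m := by exact_mod_cast hm
  have h₁' : (0 : ℝ) ≤ t₁ := by exact_mod_cast h₁
  have h₂' : (0 : ℝ) ≤ t₂ := by exact_mod_cast h₂
  have h₃' : (0 : ℝ) ≤ t₃ := by exact_mod_cast h₃
  have hsum : 0 < (t₁ : ℝ) * σ (algebraMap (𝓞 K) K ((u₁ : 𝓞 K) ^ 2)) +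
      t₂ * σ (algebraMap (𝓞 K) K ((u₂ : 𝓞 K) ^ 2)) +
      t₃ * σ (algebraMap (𝓞 K) K ((u₃ : 𝓞 K) ^ 2)) := by
    obtain h | h | h : 0 < t₁ ∨ 0 < t₂ ∨ 0 < t₃ := by omega
    all_goals
      have : (0 : ℝ) < _ := Int.cast_pos.2 h
      positivity
  rw [← h'] at hsum
  exact (mul_pos_iff_of_pos_left hm').1 hsum

theorem norm_sq_unit (u : (𝓞 K)ˣ) : Algebra.norm ℤ ((u : 𝓞 K) ^ 2) = 1 := by
  rw [map_pow]
  rcases Int.isUnit_iff.1 (u.isUnit.map (Algebra.norm ℤ)) with h | h <;> rw [h] <;> norm_num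

theorem isIndecomposable_mul_sq {α : 𝓞 K} (hα : IsIndecomposable α) (u : (𝓞 K)ˣ) :
    IsIndecomposable (α * (u : 𝓞 K) ^ 2) := by
  refine ⟨isTotallyPositive_mul_sq hα.1 u, ?_⟩
  rintro ⟨β, γ, hβ, hγ, h⟩
  refine hα.2 ⟨β * ((u⁻¹ : (𝓞 K)ˣ) : 𝓞 K) ^ 2, γ * ((u⁻¹ : (𝓞 K)ˣ) : 𝓞 K) ^ 2,
    isTotallyPositive_mul_sq hβ _, isTotallyPositive_mul_sq hγ _, ?_⟩
  rw [← add_mul, ← h, mul_assoc, ← mul_pow, Units.mul_inv, one_pow, mul_one]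

variable [CharZero K]

/-- An indecomposable element in the cone of three squares of units is one of the squares, or it
has small coordinates. -/
theorem eq_sq_or_lt {β : 𝓞 K} (hβ : IsIndecomposable β) {m t₁ t₂ t₃ : ℤ} (u₁ u₂ u₃ : (𝓞 K)ˣ)
    (hm : 0 < m) (h₂ : 0 ≤ t₂) (h₃ : 0 ≤ t₃)
    (h : m * β = t₁ * (u₁ : 𝓞 K) ^ 2 + t₂ * (u₂ : 𝓞 K) ^ 2 + t₃ * (u₃ : 𝓞 K) ^ 2) :
    β = (u₁ : 𝓞 K) ^ 2 ∨ t₁ < m := by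
  refine or_iff_not_imp_right.2 fun hlt => ?_
  push Not at hlt
  -- If `t₁ ≥ m`, then `β - u₁²` stays in the cone, hence is zero or totally positive.
  have e : (m : 𝓞 K) * (β - (u₁ : 𝓞 K) ^ 2) = ((t₁ - m : ℤ) : 𝓞 K) * (u₁ : 𝓞 K) ^ 2 +
      t₂ * (u₂ : 𝓞 K) ^ 2 + t₃ * (u₃ : 𝓞 K) ^ 2 := by
    push_cast
    linear_combination h
  rcases (show 0 ≤ t₁ - m + t₂ + t₃ by omega).eq_or_lt with h0 | h0
  · obtain ⟨h1, rfl, rfl⟩ : t₁ - m = 0 ∧ t₂ = 0 ∧ t₃ = 0 := by omega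
    have hm' : (m : 𝓞 K) ≠ 0 := by exact_mod_cast hm.ne'
    have := mul_left_cancel₀ hm' (e.trans (show _ = (m : 𝓞 K) * 0 by simp [h1]))
    exact sub_eq_zero.1 this
  · exfalso
    have hp := isTotallyPositive_of_mul_eq u₁ u₂ u₃ hm (by omega) h₂ h₃ h0 e
    have h1 : IsTotallyPositive (((u₁ : 𝓞 K) ^ 2 : 𝓞 K) : K) := fun σ => map_unit_sq_pos σ u₁
    exact hβ.2 ⟨_, _, h1, hp, by ring⟩

theorem norm_eq_one_or_lt {β : 𝓞 K} (hβ : IsIndecomposable β) {m t₁ t₂ t₃ : ℤ}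
    (u₁ u₂ u₃ : (𝓞 K)ˣ) (hm : 0 < m) (h₁ : 0 ≤ t₁) (h₂ : 0 ≤ t₂) (h₃ : 0 ≤ t₃)
    (h : m * β = t₁ * (u₁ : 𝓞 K) ^ 2 + t₂ * (u₂ : 𝓞 K) ^ 2 + t₃ * (u₃ : 𝓞 K) ^ 2) :
    Algebra.norm ℤ β = 1 ∨ t₁ < m ∧ t₂ < m ∧ t₃ < m := by
  rcases eq_sq_or_lt hβ u₁ u₂ u₃ hm h₂ h₃ h with rfl | l₁
  · exact Or.inl (norm_sq_unit _)
  rcases eq_sq_or_lt hβ (t₁ := t₂) u₂ u₁ u₃ hm h₁ h₃ (by rw [h]; ring) with rfl | l₂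
  · exact Or.inl (norm_sq_unit _)
  rcases eq_sq_or_lt hβ (t₁ := t₃) u₃ u₁ u₂ hm h₁ h₂ (by rw [h]; ring) with rfl | l₃
  · exact Or.inl (norm_sq_unit _)
  exact Or.inr ⟨l₁, l₂, l₃⟩

end Positive

/-! ### Unit multiplication and cone coordinates -/

section Multiplication

variable {K : Type*} [Field K] {θ : 𝓞 K} {a : ℤ}

theorem elt_add (θ : 𝓞 K) (x y z x' y' z' : ℤ) :
    elt θ x y z + elt θ x' y' z' = elt θ (x + x') (y + y') (z + z') := by
  simp only [elt]
  push_cast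
  ring

/-- The root `θ` as a unit. -/
def unitRoot (hθ : θ ^ 3 = a * θ ^ 2 + (a + 3) * θ + 1) : (𝓞 K)ˣ where
  val := θ
  inv := elt θ (-(a + 3)) (-a) 1
  val_inv := by simp only [elt]; push_cast; linear_combination hθ
  inv_val := by simp only [elt]; push_cast; linear_combination hθ

/-- The unit `1 + θ`. -/
def unitSucc (hθ : θ ^ 3 = a * θ ^ 2 + (a + 3) * θ + 1) : (𝓞 K)ˣ where
  val := 1 + θ
  inv := elt θ 2 (a + 1) (-1)
  val_inv := by simp only [elt]; push_cast; linear_combination -hθ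
  inv_val := by simp only [elt]; push_cast; linear_combination -hθ

variable (hθ : θ ^ 3 = a * θ ^ 2 + (a + 3) * θ + 1)

theorem elt_mul_unitRoot (x y z : ℤ) :
    elt θ x y z * (unitRoot hθ : 𝓞 K) = elt θ z (x + (a + 3) * z) (y + a * z) := by
  simp only [elt, unitRoot]
  push_cast
  linear_combination z * hθ

theorem elt_mul_unitRoot_inv (x y z : ℤ) :
    elt θ x y z * ((unitRoot hθ)⁻¹ : (𝓞 K)ˣ) = elt θ (y - (a + 3) * x) (z - a * x) x := by
  rw [Units.mul_inv_eq_iff_eq_mul, elt_mul_unitRoot hθ]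
  congr 1 <;> ring

theorem elt_mul_unitSucc (x y z : ℤ) :
    elt θ x y z * (unitSucc hθ : 𝓞 K) =
      elt θ (x + z) (x + y + (a + 3) * z) (y + (a + 1) * z) := by
  simp only [elt, unitSucc]
  push_cast
  linear_combination z * hθ

theorem elt_mul_unitSucc_inv (x y z : ℤ) :
    elt θ x y z * ((unitSucc hθ)⁻¹ : (𝓞 K)ˣ) =
      elt θ (2 * x - y + z) ((a + 1) * x - (a + 1) * y + (a + 2) * z) (y - x - z) := by
  rw [Units.mul_inv_eq_iff_eq_mul, elt_mul_unitSucc hθ]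
  congr 1 <;> ring

theorem elt_mul_root_mul_unitSucc_inv (x y z : ℤ) :
    elt θ x y z * (unitRoot hθ * (unitSucc hθ)⁻¹ : (𝓞 K)ˣ) =
      elt θ (y - x - z) ((a + 2) * y - (a + 1) * x - (a + 2) * z) (x - y + 2 * z) := by
  rw [Units.val_mul, ← mul_assoc, elt_mul_unitRoot, elt_mul_unitSucc_inv]
  congr 1 <;> ring

theorem elt_mul_unitSucc_mul_root_inv (x y z : ℤ) :
    elt θ x y z * (unitSucc hθ * (unitRoot hθ)⁻¹ : (𝓞 K)ˣ) =
      elt θ (y - (a + 2) * x) (y + z - a * x) (x + z) := by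
  rw [Units.val_mul, ← mul_assoc, elt_mul_unitSucc, elt_mul_unitRoot_inv]
  congr 1 <;> ring

theorem elt_mul_unitSucc_inv_sq (x y z : ℤ) :
    ∃ x' y' z' : ℤ, x' + z' = 2 * x - y + z ∧
      elt θ x y z * (((unitSucc hθ)⁻¹ : (𝓞 K)ˣ) : 𝓞 K) ^ 2 = elt θ x' y' z' := by
  refine ⟨_, _, _, ?_, by rw [pow_two, ← mul_assoc, elt_mul_unitSucc_inv, elt_mul_unitSucc_inv]⟩
  ring

theorem elt_mul_root_mul_unitSucc_inv_sq (x y z : ℤ) :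
    ∃ x' y' z' : ℤ, x' + z' = x - y + 2 * z ∧
      elt θ x y z * ((unitRoot hθ * (unitSucc hθ)⁻¹ : (𝓞 K)ˣ) : 𝓞 K) ^ 2 = elt θ x' y' z' := by
  refine ⟨_, _, _, ?_, by rw [pow_two, ← mul_assoc, elt_mul_root_mul_unitSucc_inv,
    elt_mul_root_mul_unitSucc_inv]⟩
  ring

/-- The excess over `2(x + z)` is a coordinate of `mul_elt`, so minimality of `2(x + z)` makes that
coordinate nonnegative. -/
theorem elt_mul_unitSucc_sq (x y z : ℤ) :
    ∃ x' y' z' : ℤ, 2 * x' - y' + 2 * z' =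
        2 * (x + z) + ((a + 2) * y + (a ^ 2 + 3 * a + 3) * z) ∧
      elt θ x y z * (unitSucc hθ : 𝓞 K) ^ 2 = elt θ x' y' z' := by
  refine ⟨_, _, _, ?_, by rw [pow_two, ← mul_assoc, elt_mul_unitSucc, elt_mul_unitSucc]⟩
  ring

theorem elt_mul_unitSucc_mul_root_inv_sq (x y z : ℤ) :
    ∃ x' y' z' : ℤ, 2 * x' - y' + 2 * z' =
        2 * (x + z) + ((a ^ 2 + 3 * a + 3) * x - (a + 1) * y) ∧
      elt θ x y z * ((unitSucc hθ * (unitRoot hθ)⁻¹ : (𝓞 K)ˣ) : 𝓞 K) ^ 2 = elt θ x' y' z' := by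
  refine ⟨_, _, _, ?_, by rw [pow_two, ← mul_assoc, elt_mul_unitSucc_mul_root_inv,
    elt_mul_unitSucc_mul_root_inv]⟩
  ring

theorem two_mul_elt (x y z : ℤ) :
    ((2 : ℤ) : 𝓞 K) * elt θ x y z = ((2 * x - y : ℤ) : 𝓞 K) * ((1 : (𝓞 K)ˣ) : 𝓞 K) ^ 2 +
      ((2 * z - y : ℤ) : 𝓞 K) * (unitRoot hθ : 𝓞 K) ^ 2 + y * (unitSucc hθ : 𝓞 K) ^ 2 := by
  simp only [elt, unitRoot, unitSucc, Units.val_one]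
  push_cast
  ring

theorem root_mul_unitSucc_inv_sq :
    ((unitRoot hθ * (unitSucc hθ)⁻¹ : (𝓞 K)ˣ) : 𝓞 K) ^ 2 =
      elt θ (-(a + 1)) (-(a ^ 2 + 3 * a + 3)) (a + 2) := by
  have h := elt_mul_root_mul_unitSucc_inv hθ 1 0 0
  have h1 : elt θ 1 0 0 = 1 := by simp [elt]
  rw [h1, one_mul] at h
  rw [pow_two]
  nth_rewrite 1 [h]
  rw [elt_mul_root_mul_unitSucc_inv]
  congr 1 <;> ring

theorem mul_elt (x y z : ℤ) :
    ((a ^ 2 + 3 * a + 3 : ℤ) : 𝓞 K) * elt θ x y z =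
      (((a ^ 2 + 3 * a + 3) * x - (a + 1) * y : ℤ) : 𝓞 K) * ((1 : (𝓞 K)ˣ) : 𝓞 K) ^ 2 +
      (((a + 2) * y + (a ^ 2 + 3 * a + 3) * z : ℤ) : 𝓞 K) * (unitRoot hθ : 𝓞 K) ^ 2 +
      ((-y : ℤ) : 𝓞 K) * ((unitRoot hθ * (unitSucc hθ)⁻¹ : (𝓞 K)ˣ) : 𝓞 K) ^ 2 := by
  rw [root_mul_unitSucc_inv_sq]
  simp only [elt, unitRoot, Units.val_one]
  push_cast
  ring

/-- The lattice points `p, q, r ≥ 0`, `p + q + r = a`, parametrize the elements at height one inside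
the second cone. -/
def triangleElt (θ : 𝓞 K) (a p q : ℤ) : 𝓞 K := elt θ (-p) (-(q + p * (a + 2) + 1)) (1 + p)

end Multiplication

theorem isTotallyPositive_triangleElt {K : Type*} [Field K] {θ : 𝓞 K} {a : ℤ}
    (hθ : θ ^ 3 = a * θ ^ 2 + (a + 3) * θ + 1) {p q r : ℤ}
    (hp : 0 ≤ p) (hq : 0 ≤ q) (hr : 0 ≤ r) (hs : p + q + r = a) :
    IsTotallyPositive (triangleElt θ a p q : K) := by
  have ha : 0 ≤ a := by omega
  have h1 := mul_nonneg (show 0 ≤ a + 2 by omega) hp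
  have h2 := mul_nonneg (show 0 ≤ a + 2 by omega) hq
  have h3 := mul_nonneg (show 0 ≤ a + 2 by omega) hr
  refine isTotallyPositive_of_mul_eq _ _ _ (by positivity) ?_ ?_ ?_ ?_ (mul_elt hθ _ _ _)
  all_goals nlinarith


/-! ### Reduction to the cones, norms and indecomposability -/

section Field

variable {K : Type*} [Field K] [NumberField K] {θ : 𝓞 K} {a : ℤ}

theorem add_pos_of_totallyPositive (hθ : θ ^ 3 = a * θ ^ 2 + (a + 3) * θ + 1)
    (hK : IntermediateField.adjoin ℚ {(θ : K)} = ⊤) {x y z : ℤ}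
    (h : IsTotallyPositive (elt θ x y z : K)) : 0 < x + z := by
  obtain ⟨Φ, h1, h2⟩ := exists_positive_functional hθ hK
  have := h2 _ h
  rw [h1] at this
  exact_mod_cast this

/-- The last two forms are `x + z` evaluated after multiplication by `(θ / (1 + θ))²` and `(1 +
θ)⁻²`. -/
theorem forms_pos_of_totallyPositive (hθ : θ ^ 3 = a * θ ^ 2 + (a + 3) * θ + 1)
    (hK : IntermediateField.adjoin ℚ {(θ : K)} = ⊤) {x y z : ℤ}
    (h : IsTotallyPositive (elt θ x y z : K)) :
    0 < x + z ∧ 0 < x - y + 2 * z ∧ 0 < 2 * x - y + z := by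
  obtain ⟨x₁, y₁, z₁, e₁, h₁⟩ := elt_mul_root_mul_unitSucc_inv_sq hθ x y z
  obtain ⟨x₂, y₂, z₂, e₂, h₂⟩ := elt_mul_unitSucc_inv_sq hθ x y z
  refine ⟨add_pos_of_totallyPositive hθ hK h, ?_, ?_⟩
  · rw [← e₁]
    exact add_pos_of_totallyPositive hθ hK (h₁ ▸ isTotallyPositive_mul_sq h _)
  · rw [← e₂]
    exact add_pos_of_totallyPositive hθ hK (h₂ ▸ isTotallyPositive_mul_sq h _)

theorem eq_zero_of_elt_eq_zero (hθ : θ ^ 3 = a * θ ^ 2 + (a + 3) * θ + 1)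
    (hK : IntermediateField.adjoin ℚ {(θ : K)} = ⊤) {x y z : ℤ} (h : elt θ x y z = 0) :
    x = 0 ∧ y = 0 ∧ z = 0 := by
  obtain ⟨Φ, hΦ, -⟩ := exists_positive_functional hθ hK
  have key : ∀ {x y z : ℤ}, elt θ x y z = 0 → x + z = 0 := by
    intro x y z h
    have := hΦ x y z
    rw [h, map_zero] at this
    exact_mod_cast this.symm
  obtain ⟨x₁, y₁, z₁, e₁, h₁⟩ := elt_mul_root_mul_unitSucc_inv_sq hθ x y z
  obtain ⟨x₂, y₂, z₂, e₂, h₂⟩ := elt_mul_unitSucc_inv_sq hθ x y z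
  rw [h, zero_mul] at h₁ h₂
  have := key h
  have := key h₁.symm
  have := key h₂.symm
  omega

theorem norm_elt (hθ : θ ^ 3 = a * θ ^ 2 + (a + 3) * θ + 1)
    (hK : IntermediateField.adjoin ℚ {(θ : K)} = ⊤)
    (hO : integralClosure ℤ K = Algebra.adjoin ℤ {(θ : K)}) (x y z : ℤ) :
    Algebra.norm ℤ (elt θ x y z) =
      Matrix.det !![x, z, y + a * z;
        y, x + (a + 3) * z, z + (a + 3) * (y + a * z);
        z, y + a * z, x + (a + 3) * z + a * (y + a * z)] := by
  let f : (Fin 3 → ℤ) →ₗ[ℤ] 𝓞 K :=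
    { toFun := fun v => elt θ (v 0) (v 1) (v 2)
      map_add' := fun v w => (elt_add θ _ _ _ _ _ _).symm
      map_smul' := fun c v => by
        simp only [elt, Pi.smul_apply, smul_eq_mul, RingHom.id_apply, zsmul_eq_mul]
        push_cast
        ring }
  have hf : ∀ v, f v = elt θ (v 0) (v 1) (v 2) := fun _ => rfl
  have hb : Function.Bijective f := by
    refine ⟨(injective_iff_map_eq_zero f).2 fun v hv => ?_, fun α => ?_⟩
    · obtain ⟨h0, h1, h2⟩ := eq_zero_of_elt_eq_zero hθ hK (hf v ▸ hv)
      ext i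
      fin_cases i <;> assumption
    · obtain ⟨x, y, z, rfl⟩ := exists_eq_elt hθ hO α
      exact ⟨![x, y, z], rfl⟩
  let e := LinearEquiv.ofBijective f hb
  let b := Module.Basis.ofEquivFun e.symm
  have hr : ∀ x y z, b.repr (elt θ x y z) = ![x, y, z] := fun x y z => by
    have : e.symm (elt θ x y z) = ![x, y, z] := e.symm_apply_eq.2 rfl
    rw [← this]
    rfl
  have hbi : ∀ i, b i = e (Pi.single i 1) := fun i => by simp [b]
  have hb0 : b 0 = elt θ 1 0 0 := by rw [hbi]; rfl
  have hb1 : b 1 = elt θ 0 1 0 := by rw [hbi]; rfl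
  have hb2 : b 2 = elt θ 0 0 1 := by rw [hbi]; rfl
  have m0 : elt θ x y z * b 0 = elt θ x y z := by simp [hb0, elt]
  have m1 : elt θ x y z * b 1 = elt θ z (x + (a + 3) * z) (y + a * z) := by
    rw [← elt_mul_unitRoot hθ, hb1]; simp [elt, unitRoot]
  have m2 : elt θ x y z * b 2 = elt θ (y + a * z) (z + (a + 3) * (y + a * z))
      (x + (a + 3) * z + a * (y + a * z)) := by
    rw [← elt_mul_unitRoot hθ, ← elt_mul_unitRoot hθ, hb2]; simp [elt, unitRoot]; ring
  rw [Algebra.norm_eq_matrix_det b]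
  congr 1
  ext i j
  rw [Algebra.leftMulMatrix_eq_repr_mul]
  fin_cases j
  · change b.repr (elt θ x y z * b 0) i = _
    rw [m0, hr]
    fin_cases i <;> rfl
  · change b.repr (elt θ x y z * b 1) i = _
    rw [m1, hr]
    fin_cases i <;> rfl
  · change b.repr (elt θ x y z * b 2) i = _
    rw [m2, hr]
    fin_cases i <;> rfl

/-- Up to squares of units, every totally positive element lies in one of two simplicial cones. -/
theorem exists_mul_sq_mem_cone (hθ : θ ^ 3 = a * θ ^ 2 + (a + 3) * θ + 1)
    (hK : IntermediateField.adjoin ℚ {(θ : K)} = ⊤)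
    (hO : integralClosure ℤ K = Algebra.adjoin ℤ {(θ : K)}) {α : 𝓞 K}
    (hα : IsTotallyPositive (α : K)) :
    ∃ (u : (𝓞 K)ˣ) (x y z : ℤ), α * (u : 𝓞 K) ^ 2 = elt θ x y z ∧
      (0 ≤ 2 * x - y ∧ 0 ≤ 2 * z - y ∧ 0 ≤ y ∨
        0 ≤ (a ^ 2 + 3 * a + 3) * x - (a + 1) * y ∧
        0 ≤ (a + 2) * y + (a ^ 2 + 3 * a + 3) * z ∧ 0 ≤ -y) := by
  classical
  -- The two forms equal 2 on the generators of the second and of the first cone respectively.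
  -- Minimizing both over the orbit of `α` selects a cone: comparison with each neighbouring cone
  -- gives one facet inequality.
  let S : ℕ → Prop := fun k => ∃ (u : (𝓞 K)ˣ) (x y z : ℤ), α * (u : 𝓞 K) ^ 2 = elt θ x y z ∧
    ((k : ℤ) = 2 * (x + z) ∨ (k : ℤ) = 2 * x - y + 2 * z)
  have hpos : ∀ (u : (𝓞 K)ˣ) (x y z : ℤ), α * (u : 𝓞 K) ^ 2 = elt θ x y z →
      0 < x + z ∧ 0 < x - y + 2 * z ∧ 0 < 2 * x - y + z := fun u x y z h =>
    forms_pos_of_totallyPositive hθ hK (h ▸ isTotallyPositive_mul_sq hα u)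
  have hS : ∃ k, S k := by
    obtain ⟨x, y, z, h⟩ := exists_eq_elt hθ hO α
    have h' : α * ((1 : (𝓞 K)ˣ) : 𝓞 K) ^ 2 = elt θ x y z := by simpa using h
    have := (hpos 1 x y z h').1
    exact ⟨(2 * (x + z)).toNat, 1, x, y, z, h', Or.inl (by omega)⟩
  obtain ⟨u, x, y, z, h, hk⟩ := Nat.find_spec hS
  have hmin : ∀ (u : (𝓞 K)ˣ) (x y z : ℤ), α * (u : 𝓞 K) ^ 2 = elt θ x y z →
      (Nat.find hS : ℤ) ≤ 2 * (x + z) ∧ (Nat.find hS : ℤ) ≤ 2 * x - y + 2 * z := by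
    intro u x y z h
    have := hpos u x y z h
    have h1 := Nat.find_min' hS (m := (2 * (x + z)).toNat) ⟨u, x, y, z, h, Or.inl (by omega)⟩
    have h2 := Nat.find_min' hS (m := (2 * x - y + 2 * z).toNat)
      ⟨u, x, y, z, h, Or.inr (by omega)⟩
    omega
  have hmul : ∀ (w : (𝓞 K)ˣ) {x' y' z' : ℤ}, elt θ x y z * (w : 𝓞 K) ^ 2 = elt θ x' y' z' →
      (Nat.find hS : ℤ) ≤ 2 * (x' + z') ∧ (Nat.find hS : ℤ) ≤ 2 * x' - y' + 2 * z' := by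
    intro w x' y' z' hw
    refine hmin (u * w) x' y' z' ?_
    rw [← hw, ← h, Units.val_mul]
    ring
  have h0 := hmin u x y z h
  refine ⟨u, x, y, z, h, ?_⟩
  rcases hk with hk | hk
  · right
    obtain ⟨x₁, y₁, z₁, e₁, h₁⟩ := elt_mul_unitSucc_mul_root_inv_sq hθ x y z
    obtain ⟨x₂, y₂, z₂, e₂, h₂⟩ := elt_mul_unitSucc_sq hθ x y z
    have := (hmul _ h₁).2
    have := (hmul _ h₂).2
    refine ⟨?_, ?_, ?_⟩ <;> linarith
  · left
    obtain ⟨x₁, y₁, z₁, e₁, h₁⟩ := elt_mul_root_mul_unitSucc_inv_sq hθ x y z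
    obtain ⟨x₂, y₂, z₂, e₂, h₂⟩ := elt_mul_unitSucc_inv_sq hθ x y z
    have := (hmul _ h₁).1
    have := (hmul _ h₂).1
    refine ⟨?_, ?_, ?_⟩ <;> linarith

theorem norm_triangleElt (hθ : θ ^ 3 = a * θ ^ 2 + (a + 3) * θ + 1)
    (hK : IntermediateField.adjoin ℚ {(θ : K)} = ⊤)
    (hO : integralClosure ℤ K = Algebra.adjoin ℤ {(θ : K)}) (p q : ℤ) :
    Algebra.norm ℤ (triangleElt θ a p q) = triangleNorm a p q := by
  rw [triangleElt, norm_elt hθ hK hO, Matrix.det_fin_three, triangleNorm]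
  simp
  ring

theorem norm_one_add_add (hθ : θ ^ 3 = a * θ ^ 2 + (a + 3) * θ + 1)
    (hK : IntermediateField.adjoin ℚ {(θ : K)} = ⊤)
    (hO : integralClosure ℤ K = Algebra.adjoin ℤ {(θ : K)}) :
    Algebra.norm ℤ (elt θ 1 1 1) = a ^ 2 + 3 * a + 9 := by
  rw [norm_elt hθ hK hO, Matrix.det_fin_three]
  simp
  ring

theorem isIndecomposable_triangleElt (hθ : θ ^ 3 = a * θ ^ 2 + (a + 3) * θ + 1)
    (hK : IntermediateField.adjoin ℚ {(θ : K)} = ⊤)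
    (hO : integralClosure ℤ K = Algebra.adjoin ℤ {(θ : K)}) {p q r : ℤ}
    (hp : 0 ≤ p) (hq : 0 ≤ q) (hr : 0 ≤ r) (hs : p + q + r = a) :
    IsIndecomposable (triangleElt θ a p q) := by
  refine ⟨isTotallyPositive_triangleElt hθ hp hq hr hs, ?_⟩
  rintro ⟨β, γ, hβ, hγ, h⟩
  obtain ⟨x, y, z, rfl⟩ := exists_eq_elt hθ hO β
  obtain ⟨x', y', z', rfl⟩ := exists_eq_elt hθ hO γ
  have h1 := add_pos_of_totallyPositive hθ hK hβ
  have h2 := add_pos_of_totallyPositive hθ hK hγ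
  have h3 : elt θ (x + x' - -p) (y + y' - -(q + p * (a + 2) + 1)) (z + z' - (1 + p)) = 0 := by
    rw [elt_add, triangleElt] at h
    rw [← sub_eq_zero.2 h.symm]
    simp only [elt]
    push_cast
    ring
  have := eq_zero_of_elt_eq_zero hθ hK h3
  omega

theorem isIndecomposable_one_add_add (hθ : θ ^ 3 = a * θ ^ 2 + (a + 3) * θ + 1)
    (hK : IntermediateField.adjoin ℚ {(θ : K)} = ⊤)
    (hO : integralClosure ℤ K = Algebra.adjoin ℤ {(θ : K)}) :
    IsIndecomposable (elt θ 1 1 1) := by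
  refine ⟨isTotallyPositive_of_mul_eq _ _ _ (by norm_num) ?_ ?_ ?_ ?_ (two_mul_elt hθ _ _ _), ?_⟩
  iterate 4 norm_num
  rintro ⟨β, γ, hβ, hγ, h⟩
  obtain ⟨x, y, z, rfl⟩ := exists_eq_elt hθ hO β
  obtain ⟨x', y', z', rfl⟩ := exists_eq_elt hθ hO γ
  -- All three forms equal 2 at `1 + θ + θ²`, so they would all be 1 at `β`; equality of the last
  -- two gives `x = z`, contradicting `x + z = 1`.
  have h1 := forms_pos_of_totallyPositive hθ hK hβ
  have h2 := forms_pos_of_totallyPositive hθ hK hγ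
  have h3 : elt θ (x + x' - 1) (y + y' - 1) (z + z' - 1) = 0 := by
    rw [elt_add] at h
    rw [← sub_eq_zero.2 h.symm]
    simp only [elt]
    push_cast
    ring
  have := eq_zero_of_elt_eq_zero hθ hK h3
  omega

end Field

/-- A lattice point at height one in the second cone, other than a vertex, has nonnegative
coordinates. -/
theorem coord_nonneg {a p q r : ℤ} (ha : -1 ≤ a) (hs : p + q + r = a)
    (h₁ : 0 ≤ 1 + q + (a + 2) * p) (h₂ : 0 ≤ 1 + p + (a + 2) * r)
    (h₃ : 1 + r + (a + 2) * q - (1 + q + (a + 2) * p) < a ^ 2 + 3 * a + 3) : 0 ≤ p := by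
  by_contra! hp
  obtain rfl : r = a - p - q := by linarith
  rcases ha.eq_or_lt with rfl | ha
  · omega
  · have ha : 0 ≤ a := ha
    have h4 := mul_nonneg ha h₁
    -- With `t₃` the expression in `h₁`, the left side of `h₃` is `a t₃ - pD`, at least `D` when `p
    -- ≤ -1`.
    nlinarith [mul_nonneg (show 0 ≤ a ^ 2 + 3 * a + 3 by positivity) (show 0 ≤ -1 - p by omega)]

/-! ### The bound and its sharpness -/

section Bound

variable {K : Type*} [Field K] [NumberField K] {θ : 𝓞 K} {a : ℤ}

theorem norm_of_mem_first_cone (hθ : θ ^ 3 = a * θ ^ 2 + (a + 3) * θ + 1)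
    (hK : IntermediateField.adjoin ℚ {(θ : K)} = ⊤)
    (hO : integralClosure ℤ K = Algebra.adjoin ℤ {(θ : K)}) {x y z : ℤ}
    (h : IsIndecomposable (elt θ x y z)) (h₁ : 0 ≤ 2 * x - y) (h₂ : 0 ≤ 2 * z - y) (h₃ : 0 ≤ y) :
    Algebra.norm ℤ (elt θ x y z) = 1 ∨ Algebra.norm ℤ (elt θ x y z) = a ^ 2 + 3 * a + 9 := by
  refine (norm_eq_one_or_lt h _ _ _ two_pos h₁ h₂ h₃ (two_mul_elt hθ x y z)).imp_right ?_
  rintro ⟨l₁, l₂, l₃⟩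
  have := add_pos_of_totallyPositive hθ hK h.1
  -- The coordinates are 0 or 1, of equal parity and not all zero, so all are 1.
  obtain ⟨rfl, rfl, rfl⟩ : x = 1 ∧ y = 1 ∧ z = 1 := by omega
  exact norm_one_add_add hθ hK hO

theorem norm_of_mem_second_cone (ha : -1 ≤ a) (hθ : θ ^ 3 = a * θ ^ 2 + (a + 3) * θ + 1)
    (hK : IntermediateField.adjoin ℚ {(θ : K)} = ⊤)
    (hO : integralClosure ℤ K = Algebra.adjoin ℤ {(θ : K)}) {x y z : ℤ}
    (h : IsIndecomposable (elt θ x y z)) (h₁ : 0 ≤ (a ^ 2 + 3 * a + 3) * x - (a + 1) * y)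
    (h₂ : 0 ≤ (a + 2) * y + (a ^ 2 + 3 * a + 3) * z) (h₃ : 0 ≤ -y) :
    Algebra.norm ℤ (elt θ x y z) = 1 ∨ ∃ p q r : ℤ, 0 ≤ p ∧ 0 ≤ q ∧ 0 ≤ r ∧ p + q + r = a ∧
      Algebra.norm ℤ (elt θ x y z) = triangleNorm a p q := by
  have hD : 0 < a ^ 2 + 3 * a + 3 := by nlinarith
  refine (norm_eq_one_or_lt h _ _ _ hD h₁ h₂ h₃ (mul_elt hθ x y z)).imp_right ?_
  rintro ⟨l₁, l₂, l₃⟩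
  have hn := add_pos_of_totallyPositive hθ hK h.1
  -- The three coordinates sum to `D(x + z)` and each is below `D`.
  have hn3 : x + z < 3 := by nlinarith
  obtain ⟨p, rfl⟩ : ∃ p, x = -p := ⟨-x, by ring⟩
  obtain hz | hz : z = 1 + p ∨ z = 2 + p := by omega
  · subst hz
    obtain ⟨q, rfl⟩ : ∃ q, y = -(q + p * (a + 2) + 1) := ⟨-y - p * (a + 2) - 1, by ring⟩
    obtain ⟨r, hr⟩ : ∃ r, r = a - p - q := ⟨_, rfl⟩
    have e₁ : (a ^ 2 + 3 * a + 3) * -p - (a + 1) * -(q + p * (a + 2) + 1) =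
      1 + r + (a + 2) * q := by rw [hr]; ring
    have e₂ : (a + 2) * -(q + p * (a + 2) + 1) + (a ^ 2 + 3 * a + 3) * (1 + p) =
      1 + p + (a + 2) * r := by rw [hr]; ring
    have e₃ : - -(q + p * (a + 2) + 1) = 1 + q + (a + 2) * p := by ring
    rw [e₁] at h₁ l₁
    rw [e₂] at h₂ l₂
    rw [e₃] at h₃ l₃
    refine ⟨p, q, r, ?_, ?_, ?_, by omega, norm_triangleElt hθ hK hO p q⟩
    · exact coord_nonneg (q := q) (r := r) ha (by omega) h₃ h₂ (by linarith)
    · exact coord_nonneg (q := r) (r := p) ha (by omega) h₁ h₃ (by linarith)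
    · exact coord_nonneg (q := p) (r := q) ha (by omega) h₂ h₁ (by linarith)
  · exfalso
    subst hz
    obtain ⟨q, rfl⟩ : ∃ q, y = -(q + p * (a + 2) + 2) := ⟨-y - p * (a + 2) - 2, by ring⟩
    -- Reflection `t ↦ D - t` of the cone coordinates brings height 2 to height 1. The three cyclic
    -- rotations of a triangle point sum to `(D, D, D)`, so the reflection of one is the sum of the
    -- other two.
    obtain ⟨p', rfl⟩ : ∃ p', p = a - p' := ⟨a - p, by ring⟩
    obtain ⟨q', rfl⟩ : ∃ q', q = a - q' := ⟨a - q, by ring⟩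
    obtain ⟨r', hr⟩ : ∃ r', r' = a - p' - q' := ⟨_, rfl⟩
    have e₁ : (a ^ 2 + 3 * a + 3) * -(a - p') - (a + 1) * -(a - q' + (a - p') * (a + 2) + 2) =
      a ^ 2 + 3 * a + 3 - (1 + r' + (a + 2) * q') := by rw [hr]; ring
    have e₂ : (a + 2) * -(a - q' + (a - p') * (a + 2) + 2) + (a ^ 2 + 3 * a + 3) * (2 + (a - p')) =
      a ^ 2 + 3 * a + 3 - (1 + p' + (a + 2) * r') := by rw [hr]; ring
    have e₃ : - -(a - q' + (a - p') * (a + 2) + 2) =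
      a ^ 2 + 3 * a + 3 - (1 + q' + (a + 2) * p') := by ring
    rw [e₁] at h₁ l₁
    rw [e₂] at h₂ l₂
    rw [e₃] at h₃ l₃
    have hp : 0 ≤ p' :=
      coord_nonneg (q := q') (r := r') ha (by omega) (by linarith) (by linarith) (by linarith)
    have hq : 0 ≤ q' :=
      coord_nonneg (q := r') (r := p') ha (by omega) (by linarith) (by linarith) (by linarith)
    have hr' : 0 ≤ r' :=
      coord_nonneg (q := p') (r := q') ha (by omega) (by linarith) (by linarith) (by linarith)
    refine h.2 ⟨triangleElt θ a q' r', triangleElt θ a r' p',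
      isTotallyPositive_triangleElt hθ hq hr' hp (by omega),
      isTotallyPositive_triangleElt hθ hr' hp hq (by omega), ?_⟩
    rw [triangleElt, triangleElt, elt_add, hr]
    congr 1 <;> ring

theorem norm_le_simplestCubicBound {A a₀ : ℤ} (ha : -1 ≤ a) (haA : a = 3 * A + a₀)
    (ha₀ : a₀ = 0 ∨ a₀ = 1 ∨ a₀ = 2) (hθ : θ ^ 3 = a * θ ^ 2 + (a + 3) * θ + 1)
    (hK : IntermediateField.adjoin ℚ {(θ : K)} = ⊤)
    (hO : integralClosure ℤ K = Algebra.adjoin ℤ {(θ : K)}) {α : 𝓞 K} (hα : IsIndecomposable α) :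
    Algebra.norm ℤ α ≤ simplestCubicBound A a₀ := by
  have hB := haA ▸ le_simplestCubicBound (A := A) ha₀
  have h1 : 1 ≤ simplestCubicBound A a₀ := by nlinarith
  obtain ⟨u, x, y, z, h, hc⟩ := exists_mul_sq_mem_cone hθ hK hO hα.1
  have hi := h ▸ isIndecomposable_mul_sq hα u
  have hN : Algebra.norm ℤ α = Algebra.norm ℤ (elt θ x y z) := by
    rw [← h, map_mul, norm_sq_unit, mul_one]
  rw [hN]
  rcases hc with ⟨h₁, h₂, h₃⟩ | ⟨h₁, h₂, h₃⟩
  · rcases norm_of_mem_first_cone hθ hK hO hi h₁ h₂ h₃ with e | e <;> rw [e] <;> assumption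
  · rcases norm_of_mem_second_cone ha hθ hK hO hi h₁ h₂ h₃ with e | ⟨p, q, r, hp, hq, hr, hs, e⟩
    · rwa [e]
    · rw [e]
      subst haA
      exact (triangleNorm_le ha₀ hp hq hr hs).trans (simplestCubicBound_of_nonneg ha₀ (by omega))

theorem exists_norm_eq_simplestCubicBound {A a₀ : ℤ} (haA : a = 3 * A + a₀)
    (ha₀ : a₀ = 0 ∨ a₀ = 1 ∨ a₀ = 2) (hθ : θ ^ 3 = a * θ ^ 2 + (a + 3) * θ + 1)
    (hK : IntermediateField.adjoin ℚ {(θ : K)} = ⊤)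
    (hO : integralClosure ℤ K = Algebra.adjoin ℤ {(θ : K)}) :
    ∃ α : 𝓞 K, IsIndecomposable α ∧ Algebra.norm ℤ α = simplestCubicBound A a₀ := by
  by_cases h : a ≤ 3
  · refine ⟨_, isIndecomposable_one_add_add hθ hK hO, ?_⟩
    rw [norm_one_add_add hθ hK hO, simplestCubicBound, if_pos (haA ▸ h), haA]
  · have hA : 0 ≤ A := by omega
    rw [simplestCubicBound, if_neg (haA ▸ h)]
    -- The witnesses are lattice points nearest the centroid of the triangle.
    rcases ha₀ with rfl | rfl | rfl
    · refine ⟨_, isIndecomposable_triangleElt hθ hK hO hA hA hA (by omega), ?_⟩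
      rw [norm_triangleElt hθ hK hO, triangleNorm, haA]
      norm_num
      ring
    · refine ⟨_, isIndecomposable_triangleElt hθ hK hO hA hA (r := A + 1) (by omega) (by omega), ?_⟩
      rw [norm_triangleElt hθ hK hO, triangleNorm, haA]
      norm_num
      ring
    · refine ⟨_, isIndecomposable_triangleElt hθ hK hO (p := A + 1) (q := A + 1) (by omega)
        (by omega) hA (by omega), ?_⟩
      rw [norm_triangleElt hθ hK hO, triangleNorm, haA]
      norm_num
      ring

end Bound

end SimplestCubic

theorem theorem1p2 {K : Type*} [Field K] [NumberField K] (ρ : K) (a A a₀ : ℤ)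
    (ha : -1 ≤ a) (haA : a = 3 * A + a₀) (ha₀ : a₀ = 0 ∨ a₀ = 1 ∨ a₀ = 2)
    (hρ : ρ ^ 3 - (a : K) * ρ ^ 2 - ((a : K) + 3) * ρ - 1 = 0)
    (hK : IntermediateField.adjoin ℚ {ρ} = ⊤)
    (hO : integralClosure ℤ K = Algebra.adjoin ℤ {ρ}) :
    (∀ α : 𝓞 K, IsIndecomposable α → Algebra.norm ℤ α ≤ simplestCubicBound A a₀) ∧
      ∃ α : 𝓞 K, IsIndecomposable α ∧ Algebra.norm ℤ α = simplestCubicBound A a₀ := by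
  have hi : ρ ∈ integralClosure ℤ K := hO ▸ Algebra.self_mem_adjoin_singleton ℤ ρ
  obtain ⟨θ, rfl⟩ : ∃ θ : 𝓞 K, (θ : K) = ρ := ⟨⟨ρ, hi⟩, rfl⟩
  have hθ : θ ^ 3 = a * θ ^ 2 + (a + 3) * θ + 1 := by
    apply NumberField.RingOfIntegers.ext
    simp only [map_add, map_mul, map_pow, map_intCast, map_one, map_ofNat]
    linear_combination hρ
  exact ⟨fun α hα => SimplestCubic.norm_le_simplestCubicBound ha haA ha₀ hθ hK hO hα,
    SimplestCubic.exists_norm_eq_simplestCubicBound haA ha₀ hθ hK hO⟩
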